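/- Let $X$ be a set (finite or infinite) and let $r\colon X\times X\to X\times X$, $r(x,y)=(\sigma_x(y),\gamma_y(x))$, be a set-theoretic solution of the Yang--Baxter equation, that is, $(r\times\mathrm{id})(\mathrm{id}\times r)(r\times\mathrm{id})=(\mathrm{id}\times r)(r\times\mathrm{id})(\mathrm{id}\times r)$ on $X^3$. Assume that $r$ is bijective and that $(X,r)$ is left and right non-degenerate, that is, all the maps $\sigma_x$ and $\gamma_y$ are bijective. Let $(M,\circ)=M(X,r)$ be the monoid generated by $X$ with the relations $x\circ y=\sigma_x(y)\circ\gamma_y(x)$ for $x,y\in X$, and let $A(X,r)$ be the monoid, written additively, generated by $X$ with the relations $x+y=y+\sigma_y\gamma_{\sigma_x^{-1}(y)}(x)$ for $x,y\in X$. Let $\lambda'\colon (M,\circ)\to\operatorname{Aut}(A(X,r),+)$ be the unique monoid homomorphism with $\lambda'_x(y)=\sigma_x(y)$ for $x,y\in X$, and let $\pi\colon M\to A(X,r)$ be the unique map with $\pi(x)=x$ for $x\in X$ and $\pi(a\circ b)=\pi(a)+\lambda'_a(\pi(b))$ for $a,b\in M$. The map $\pi$ is bijective; identify $M$ with $A(X,r)$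 through $\pi$. Thus $M$ has a second monoid structure $(M,+)$, each $\lambda'_a$ is an automorphism of $(M,+)$, and $a\circ b=a+\lambda'_a(b)$ for all $a,b\in M$. Let $\nu$ be the least congruence on $(M,\circ)$ such that $(M,\circ)/\nu$ is left cancellative, and let $\eta$ be the least congruence on $(M,+)$ such that $(M,+)/\eta$ is left cancellative. Then $\eta=\nu$. Moreover, for every $z\in M$, $$\nu=\{(\lambda'_z(a),\lambda'_z(b))\mid (a,b)\in\nu\}=\{((\lambda'_z)^{-1}(a),(\lambda'_z)^{-1}(b))\mid (a,b)\in\nu\},$$ and $\lambda'_a=\lambda'_b$ for all $(a,b)\in\eta$. -/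

import Mathlib

namespace YangBaxter

universe u

/-- The map `r × id` on `X³`. -/
def r12 {X : Type u} (r : X × X → X × X) (t : X × X × X) : X × X × X :=
  ((r (t.1, t.2.1)).1, (r (t.1, t.2.1)).2, t.2.2)

/-- The map `id × r` on `X³`. -/
def r23 {X : Type u} (r : X × X → X × X) (t : X × X × X) : X × X × X :=
  (t.1, r t.2)

/-- `σ_x(y)`, the first component of `r(x,y)`. -/
def sigma {X : Type u} (r : X × X → X × X) (x y : X) : X := (r (x, y)).1

/-- `γ_y(x)`, the second component of `r(x,y)`. -/
def gamma {X : Type u} (r : X × X → X × X) (y x : X) : X := (r (x, y)).2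

/-- `(X,r)` is a set-theoretic solution of the Yang–Baxter equation (in braid form). -/
def IsSolution {X : Type u} (r : X × X → X × X) : Prop :=
  r12 r ∘ r23 r ∘ r12 r = r23 r ∘ r12 r ∘ r23 r

def IsLeftNonDegenerate {X : Type u} (r : X × X → X × X) : Prop :=
  ∀ x, Function.Bijective (sigma r x)

def IsRightNonDegenerate {X : Type u} (r : X × X → X × X) : Prop :=
  ∀ y, Function.Bijective (gamma r y)

/-- A left non-degenerate set-theoretic solution of the Yang–Baxter equation on `X`. -/
structure LeftNonDegSolution (X : Type u) where
  r : X × X → X × X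
  isSolution : IsSolution r
  leftNonDeg : IsLeftNonDegenerate r

/-- The defining relations `x ∘ y = σ_x(y) ∘ γ_y(x)` of the structure monoid of `(X,r)`. -/
inductive StrRel {X : Type u} (r : X × X → X × X) : FreeMonoid X → FreeMonoid X → Prop
  | swap (x y : X) : StrRel r (FreeMonoid.of x * FreeMonoid.of y)
      (FreeMonoid.of (sigma r x y) * FreeMonoid.of (gamma r y x))

/-- The same relations, written additively. -/
inductive AddStrRel {X : Type u} (r : X × X → X × X) :
    FreeAddMonoid X → FreeAddMonoid X → Prop
  | swap (x y : X) : AddStrRel r (FreeAddMonoid.of x + FreeAddMonoid.of y)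
      (FreeAddMonoid.of (sigma r x y) + FreeAddMonoid.of (gamma r y x))

namespace LeftNonDegSolution

variable {X : Type u} (S : LeftNonDegSolution X)

/-- `σ_x` as a permutation of `X`. -/
noncomputable def sig (x : X) : Equiv.Perm X := Equiv.ofBijective (sigma S.r x) (S.leftNonDeg x)

/-- `γ_y`. -/
def gam (y x : X) : X := gamma S.r y x

theorem braid1 (x y z : X) : S.sig (S.sig x y) (S.sig (S.gam y x) z) = S.sig x (S.sig y z) :=
  congrArg (fun t => t.1) (congrFun S.isSolution (x, y, z))

theorem braid2 (x y z : X) : S.gam (S.sig (S.gam y x) z) (S.sig x y) =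
    S.sig (S.gam (S.sig y z) x) (S.gam z y) :=
  congrArg (fun t => t.2.1) (congrFun S.isSolution (x, y, z))

theorem braid3 (x y z : X) : S.gam z (S.gam y x) = S.gam (S.gam z y) (S.gam (S.sig y z) x) :=
  congrArg (fun t => t.2.2) (congrFun S.isSolution (x, y, z))

/-- The left derived solution `r'(x,y) = (y, σ_y γ_{σ_x⁻¹(y)}(x))`. -/
noncomputable def derived (p : X × X) : X × X :=
  (p.2, S.sig p.2 (S.gam ((S.sig p.1).symm p.2) p.1))

/-- The structure monoid `(M,∘)`, `M = M(X,r)`; the operation `∘` is written `*`. -/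
def M : Type u := PresentedMonoid (StrRel S.r)

instance : Monoid S.M := inferInstanceAs (Monoid (PresentedMonoid (StrRel S.r)))

/-- The structure monoid `A(X,r) = M(X,r')` of the left derived solution, written additively. -/
abbrev A : Type u := PresentedAddMonoid (AddStrRel S.derived)

/-- The generators of `M(X,r)`. -/
def of (x : X) : S.M := PresentedMonoid.of (StrRel S.r) x

/-- The generators of `A(X,r)`. -/
def ofA (x : X) : S.A := PresentedAddMonoid.of (AddStrRel S.derived) x

theorem of_mul_of (x y : X) : S.of x * S.of y = S.of (S.sig x y) * S.of (S.gam y x) :=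
  PresentedMonoid.mk_eq_mk_of_rel (StrRel.swap (r := S.r) x y)

theorem ofA_add_ofA' (x y : X) : S.ofA x + S.ofA y =
    S.ofA y + S.ofA (S.sig y (S.gam ((S.sig x).symm y) x)) :=
  Quotient.sound (AddConGen.Rel.of _ _ (AddStrRel.swap (r := S.derived) x y))

theorem ofA_add_ofA (x y : X) : S.ofA x + S.ofA (S.sig x y) =
    S.ofA (S.sig x y) + S.ofA (S.sig (S.sig x y) (S.gam y x)) := by
  simpa using S.ofA_add_ofA' x (S.sig x y)

/-- A homomorphism out of `(M,∘)` from its values on generators. -/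
def liftM {N : Type*} [Monoid N] (f : X → N)
    (h : ∀ x y, f x * f y = f (S.sig x y) * f (S.gam y x)) : S.M →* N :=
  PresentedMonoid.lift f (rels := StrRel S.r) (by
    rintro _ _ ⟨x, y⟩
    simp only [map_mul, FreeMonoid.lift_eval_of]
    exact h x y)

@[simp] theorem liftM_of {N : Type*} [Monoid N] (f : X → N) (h) (x : X) :
    S.liftM f h (S.of x) = f x := rfl

/-- A homomorphism out of `A(X,r)` from its values on generators. -/
def liftA {N : Type*} [AddMonoid N] (f : X → N)
    (h : ∀ x y, f x + f y = f y + f (S.sig y (S.gam ((S.sig x).symm y) x))) : S.A →+ N :=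
  PresentedAddMonoid.lift f (rels := AddStrRel S.derived) (by
    rintro _ _ ⟨x, y⟩
    simp only [map_add, FreeAddMonoid.lift_eval_of]
    exact h x y)

@[simp] theorem liftA_of {N : Type*} [AddMonoid N] (f : X → N) (h) (x : X) :
    S.liftA f h (S.ofA x) = f x := rfl

theorem M_ind {p : S.M → Prop} (h1 : p 1) (hm : ∀ x m, p m → p (S.of x * m)) (m : S.M) : p m := by
  obtain ⟨w, rfl⟩ := PresentedMonoid.surjective_mk (rels := StrRel S.r) m
  induction w using FreeMonoid.inductionOn' with
  | one => exact h1
  | of_mul x w ih => exact hm x _ ih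

theorem A_ind {p : S.A → Prop} (h0 : p 0) (ha : ∀ x a, p a → p (S.ofA x + a)) (a : S.A) : p a := by
  obtain ⟨w, rfl⟩ := PresentedAddMonoid.surjective_mk (rels := AddStrRel S.derived) a
  induction w using FreeAddMonoid.inductionOn' with
  | zero => exact h0
  | of_add x w ih => exact ha x _ ih

theorem sig_derived (x y w : X) :
    S.sig x (S.sig w (S.gam ((S.sig y).symm w) y)) =
      S.sig (S.sig x w) (S.gam ((S.sig (S.sig x y)).symm (S.sig x w)) (S.sig x y)) := by
  obtain ⟨z, rfl⟩ := (S.sig y).surjective w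
  rw [← S.braid1 x y z, Equiv.symm_apply_apply, Equiv.symm_apply_apply, S.braid2, S.braid1 x y z,
    ← S.braid1 x (S.sig y z)]

theorem sig_symm_derived (x y w : X) :
    (S.sig x).symm (S.sig w (S.gam ((S.sig y).symm w) y)) =
      S.sig ((S.sig x).symm w) (S.gam ((S.sig ((S.sig x).symm y)).symm ((S.sig x).symm w))
        ((S.sig x).symm y)) := by
  rw [Equiv.symm_apply_eq, S.sig_derived]
  simp

/-- The automorphism of `A(X,r)` that extends `σ_x`. -/
noncomputable def sigA (x : X) : S.A ≃+ S.A :=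
  AddMonoidHom.toAddEquiv
    (S.liftA (fun y => S.ofA (S.sig x y)) (fun y w => by rw [S.sig_derived, S.ofA_add_ofA']))
    (S.liftA (fun y => S.ofA ((S.sig x).symm y))
      (fun y w => by rw [S.sig_symm_derived, S.ofA_add_ofA']))
    (by
      refine AddMonoidHom.ext fun a => ?_
      induction a using S.A_ind with
      | h0 => simp
      | ha y a ih => simp only [map_add, ih]; simp)
    (by
      refine AddMonoidHom.ext fun a => ?_
      induction a using S.A_ind with
      | h0 => simp
      | ha y a ih => simp only [map_add, ih]; simp)

@[simp] theorem sigA_of (x y : X) : S.sigA x (S.ofA y) = S.ofA (S.sig x y) := rfl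

theorem sigA_braid (x y : X) (a : S.A) :
    S.sigA x (S.sigA y a) = S.sigA (S.sig x y) (S.sigA (S.gam y x) a) := by
  induction a using S.A_ind with
  | h0 => simp
  | ha z a ih => simp only [map_add, ih, sigA_of, braid1]

/-- The left action of `(M,∘)` on `A(X,r)` by automorphisms, with `x` acting as `σ_x` on `X`.
(In `AddAut`, composition is written additively.) -/
noncomputable def actA : S.M →* Multiplicative (AddAut S.A) :=
  S.liftM (fun x => Multiplicative.ofAdd (S.sigA x))
    (fun x y => AddEquiv.ext (fun a => S.sigA_braid x y a))

/-- The value of this action at `a`, as an automorphism of `A(X,r)`. -/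
noncomputable def lamA (a : S.M) : S.A ≃+ S.A := (S.actA a).toAdd

theorem lamA_of (x : X) : S.lamA (S.of x) = S.sigA x := rfl

theorem lamA_one (a : S.A) : S.lamA 1 a = a := by
  simp only [lamA, map_one]; rfl

theorem lamA_mul (m n : S.M) (a : S.A) : S.lamA (m * n) a = S.lamA m (S.lamA n a) := by
  simp only [lamA, map_mul]; rfl

/-- The action of `(M,∘)` on `A(X,r)` by affine maps, with `x` acting as `a ↦ x + σ_x(a)`. -/
noncomputable def affine : S.M →* Function.End S.A :=
  S.liftM (fun x a => S.ofA x + S.sigA x a) (fun x y => by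
    funext a
    change S.ofA x + S.sigA x (S.ofA y + S.sigA y a) =
      S.ofA _ + S.sigA _ (S.ofA _ + S.sigA _ a)
    rw [map_add, map_add, ← add_assoc, ← add_assoc, sigA_of, sigA_of, ofA_add_ofA, sigA_braid])

/-- The `1`-cocycle `π : M(X,r) → A(X,r)` with `π(x) = x` for `x ∈ X`. -/
noncomputable def cocycle (m : S.M) : S.A := S.affine m 0

theorem cocycle_one : S.cocycle 1 = 0 := by simp only [cocycle, map_one]; rfl

theorem cocycle_of_mul (x : X) (m : S.M) :
    S.cocycle (S.of x * m) = S.ofA x + S.sigA x (S.cocycle m) := by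
  simp only [cocycle, map_mul]; rfl

theorem cocycle_of (x : X) : S.cocycle (S.of x) = S.ofA x := by
  simpa [cocycle_one] using S.cocycle_of_mul x 1

theorem cocycle_mul (m n : S.M) : S.cocycle (m * n) = S.cocycle m + S.lamA m (S.cocycle n) := by
  induction m using S.M_ind with
  | h1 => simp [cocycle_one, lamA_one]
  | hm x m ih => simp only [mul_assoc, cocycle_of_mul, ih, lamA_mul, map_add, lamA_of, add_assoc]

/-- Auxiliary action of `(M,∘)` on maps `X → M`, used to construct the inverse of `π`. -/
noncomputable def auxAct : S.M →* Function.End (X → S.M) :=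
  S.liftM (fun y f x => S.of ((S.sig x).symm y) * f (S.gam ((S.sig x).symm y) x)) (fun y z => by
    funext f x
    obtain ⟨y, rfl⟩ := (S.sig x).surjective y
    obtain ⟨z, rfl⟩ := (S.sig (S.gam y x)).surjective z
    change S.of ((S.sig x).symm _) * (S.of _ * f _) = S.of ((S.sig x).symm _) * (S.of _ * f _)
    rw [S.braid1, S.braid2]
    simp only [Equiv.symm_apply_apply]
    rw [← mul_assoc, ← mul_assoc, of_mul_of, braid3])

/-- The inverse of `λ_x` on `M`, satisfying
`λ_x⁻¹(y ∘ m) = σ_x⁻¹(y) ∘ λ_{γ_{σ_x⁻¹(y)}(x)}⁻¹(m)`. -/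
noncomputable def aux (x : X) (m : S.M) : S.M := S.auxAct m (fun _ => 1) x

theorem aux_one (x : X) : S.aux x 1 = 1 := by simp only [aux, map_one]; rfl

theorem aux_sig_mul (x y : X) (m : S.M) :
    S.aux x (S.of (S.sig x y) * m) = S.of y * S.aux (S.gam y x) m := by
  have h (y) : S.aux x (S.of y * m) =
      S.of ((S.sig x).symm y) * S.aux (S.gam ((S.sig x).symm y) x) m := by
    simp only [aux, map_mul]; rfl
  simpa using h (S.sig x y)

theorem aux_braid (x y : X) (m : S.M) :
    S.aux y (S.aux x m) = S.aux (S.gam y x) (S.aux (S.sig x y) m) := by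
  induction m using S.M_ind generalizing x y with
  | h1 => simp [aux_one]
  | hm z m ih =>
    obtain ⟨z, rfl⟩ := (S.sig x).surjective z
    obtain ⟨z, rfl⟩ := (S.sig y).surjective z
    rw [aux_sig_mul, aux_sig_mul, ← braid1, aux_sig_mul, aux_sig_mul, ih, ← braid3, ← braid2]

/-- Auxiliary action of `A(X,r)` on `M`, with `x` acting as `m ↦ x ∘ λ_x⁻¹(m)`. -/
noncomputable def invAct : S.A →+ Additive (Function.End S.M) :=
  S.liftA (fun x => Additive.ofMul (fun m => S.of x * S.aux x m)) (fun x y => by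
    obtain ⟨y, rfl⟩ := (S.sig x).surjective y
    funext m
    change S.of x * S.aux x (S.of _ * S.aux _ m) = S.of _ * S.aux _ (S.of _ * S.aux _ m)
    rw [aux_sig_mul, aux_sig_mul, Equiv.symm_apply_apply, ← mul_assoc, ← mul_assoc, of_mul_of,
      aux_braid])

/-- The inverse of `π`. -/
noncomputable def cocycleInv (a : S.A) : S.M := (S.invAct a).toMul 1

theorem cocycleInv_zero : S.cocycleInv 0 = 1 := by simp only [cocycleInv, map_zero]; rfl

theorem cocycleInv_of_add (x : X) (a : S.A) :
    S.cocycleInv (S.ofA x + a) = S.of x * S.aux x (S.cocycleInv a) := by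
  simp only [cocycleInv, map_add]; rfl

theorem aux_cocycleInv (x : X) (a : S.A) : S.aux x (S.cocycleInv (S.sigA x a)) = S.cocycleInv a := by
  induction a using S.A_ind with
  | h0 => simp [cocycleInv_zero, aux_one]
  | ha y a ih =>
    rw [map_add, sigA_of, cocycleInv_of_add, aux_sig_mul, ← aux_braid, ih, cocycleInv_of_add]

theorem sigA_cocycle (x : X) (m : S.M) : S.sigA x (S.cocycle (S.aux x m)) = S.cocycle m := by
  induction m using S.M_ind generalizing x with
  | h1 => simp [aux_one, cocycle_one]
  | hm y m ih =>
    obtain ⟨y, rfl⟩ := (S.sig x).surjective y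
    rw [aux_sig_mul, cocycle_of_mul, map_add, sigA_braid, ih, cocycle_of_mul, sigA_of]

/-- The bijection `π : M(X,r) → A(X,r)`. -/
noncomputable def cocycleEquiv : S.M ≃ S.A where
  toFun := S.cocycle
  invFun := S.cocycleInv
  left_inv m := by
    induction m using S.M_ind with
    | h1 => rw [cocycle_one, cocycleInv_zero]
    | hm x m ih => rw [cocycle_of_mul, cocycleInv_of_add, aux_cocycleInv, ih]
  right_inv a := by
    induction a using S.A_ind with
    | h0 => rw [cocycleInv_zero, cocycle_one]
    | ha x a ih => rw [cocycleInv_of_add, cocycle_of_mul, sigA_cocycle, ih]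

/-- The additive structure `(M,+)`: the one of `A(X,r)`, carried over to `M` along `π`. -/
noncomputable instance : AddMonoid S.M := S.cocycleEquiv.addMonoid

/-- `π` as an isomorphism from `(M,+)` to `A(X,r)`. -/
noncomputable def cocycleAddEquiv : S.M ≃+ S.A := S.cocycleEquiv.addEquiv

/-- `λ'_a`, as an automorphism of `(M,+)`. -/
noncomputable def lam (a : S.M) : S.M ≃+ S.M :=
  (S.cocycleAddEquiv.trans (S.lamA a)).trans S.cocycleAddEquiv.symm

theorem lam_of_of (x y : X) : S.lam (S.of x) (S.of y) = S.of (sigma S.r x y) := by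
  apply S.cocycleAddEquiv.injective
  change S.cocycleAddEquiv (S.cocycleAddEquiv.symm (S.lamA (S.of x) (S.cocycle (S.of y)))) =
    S.cocycle (S.of (S.sig x y))
  rw [AddEquiv.apply_symm_apply, cocycle_of, cocycle_of, lamA_of, sigA_of]

theorem lam_mul (a b c : S.M) : S.lam (a * b) c = S.lam a (S.lam b c) := by
  simp [lam, lamA_mul]

theorem mul_eq_add_lam (a b : S.M) : a * b = a + S.lam a b := by
  apply S.cocycleAddEquiv.injective
  rw [map_add]
  change S.cocycle (a * b) = S.cocycle a +
    S.cocycleAddEquiv (S.cocycleAddEquiv.symm (S.lamA a (S.cocycle b)))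
  rw [AddEquiv.apply_symm_apply, cocycle_mul]

end LeftNonDegSolution

/-- The least left cancellative congruence of a monoid written multiplicatively. -/
def leastLeftCancelCon (N : Type u) [Monoid N] : Con N :=
  sInf {c : Con N | IsLeftCancelMul c.Quotient}

/-- The least left cancellative congruence of a monoid written additively. -/
def leastLeftCancelAddCon (N : Type u) [AddMonoid N] : AddCon N :=
  sInf {c : AddCon N | IsLeftCancelAdd c.Quotient}

theorem isLeast_leastLeftCancelCon (N : Type u) [Monoid N] :
    IsLeast {c : Con N | IsLeftCancelMul c.Quotient} (leastLeftCancelCon N) := by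
  refine ⟨⟨fun a b c h => ?_⟩, fun c hc => sInf_le hc⟩
  induction a using Con.induction_on with | _ a
  induction b using Con.induction_on with | _ b
  induction c using Con.induction_on with | _ c
  refine (Con.eq _).2 fun d hd => ?_
  have hd' : IsLeftCancelMul d.Quotient := hd
  have h' : d (a * b) (a * c) := (Con.eq _).1 h d hd
  exact (Con.eq _).1 (mul_left_cancel (a := (a : d.Quotient)) ((Con.eq _).2 h'))

theorem isLeast_leastLeftCancelAddCon (N : Type u) [AddMonoid N] :
    IsLeast {c : AddCon N | IsLeftCancelAdd c.Quotient} (leastLeftCancelAddCon N) := by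
  refine ⟨⟨fun a b c h => ?_⟩, fun c hc => sInf_le hc⟩
  induction a using AddCon.induction_on with | _ a
  induction b using AddCon.induction_on with | _ b
  induction c using AddCon.induction_on with | _ c
  refine (AddCon.eq _).2 fun d hd => ?_
  have hd' : IsLeftCancelAdd d.Quotient := hd
  have h' : d (a + b) (a + c) := (AddCon.eq _).1 h d hd
  exact (AddCon.eq _).1 (add_left_cancel (a := (a : d.Quotient)) ((AddCon.eq _).2 h'))

namespace LeftNonDegSolution

/-- `ν`, the least left cancellative congruence on `(M,∘)`. -/
def nu {X : Type u} (S : LeftNonDegSolution X) : Con S.M := leastLeftCancelCon S.M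

/-- `η`, the least left cancellative congruence on `(M,+)`. -/
noncomputable def eta {X : Type u} (S : LeftNonDegSolution X) : AddCon S.M :=
  leastLeftCancelAddCon S.M

end LeftNonDegSolution

end YangBaxter

namespace YangBaxter

/-! Both congruences turn out to consist of the pairs that some left translation identifies. For
`+`, surjectivity of `r` gives `d + M ⊆ M + d` (`exists_add_eq_add`), an Ore-type condition under
which these pairs form a congruence, which is then `η`. The two kinds of translation are compared
through `c ∘ a = c + λ'_c(a) = λ'_c((λ'_c)⁻¹(c) + a)`: since `c ↦ (λ'_c)⁻¹(c)` is surjective, which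
comes from right non-degeneracy, a pair is identified by a translation of `∘` iff by one of `+`
(`exists_mul_eq_mul_iff`). Finally `c ∘ a = c ∘ b` forces `λ'_a = λ'_b`, so `η` also respects `a ∘ c
= a + λ'_a(c)` and must equal `ν`. -/

/-- If `d + N ⊆ N + d` for all `d`, the least left cancellative congruence on `N` identifies exactly
the pairs that become equal after some left translation. -/
theorem leastLeftCancelAddCon_iff {N : Type*} [AddMonoid N]
    (hN : ∀ d c : N, ∃ c', c' + d = d + c) (a b : N) :
    leastLeftCancelAddCon N a b ↔ ∃ c, c + a = c + b := by
  let E : AddCon N :=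
    { r := fun a b => ∃ c, c + a = c + b
      iseqv :=
        { refl := fun a => ⟨0, rfl⟩
          symm := fun ⟨c, h⟩ => ⟨c, h.symm⟩
          trans := by
            rintro a b e ⟨c, h⟩ ⟨d, h'⟩
            -- `d + c = c' + d` begins on the right with both `c` and `d`, so it identifies both
            -- pairs.
            obtain ⟨c', hc⟩ := hN d c
            refine ⟨d + c, ?_⟩
            rw [add_assoc, h, ← add_assoc, ← hc, add_assoc, h', add_assoc] }
      add' := by
        rintro a b a' b' ⟨c, h⟩ ⟨d, h'⟩
        -- The factor `d` is needed next to `a'`; `hd` brings it there past `c + a`.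
        obtain ⟨d', hd⟩ := hN (c + a) d
        refine ⟨d' + c, ?_⟩
        calc d' + c + (a + a') = d' + (c + a) + a' := by simp only [add_assoc]
          _ = c + a + (d + b') := by rw [hd, add_assoc, h']
          _ = d' + (c + a) + b' := by rw [hd, add_assoc (c + a)]
          _ = d' + c + (b + b') := by rw [h]; simp only [add_assoc] }
  constructor
  · refine fun h => h E (⟨fun x y z hxyz => ?_⟩ : IsLeftCancelAdd E.Quotient)
    induction x using AddCon.induction_on with | _ x
    induction y using AddCon.induction_on with | _ y
    induction z using AddCon.induction_on with | _ z
    obtain ⟨c, hc⟩ : E (x + y) (x + z) := (AddCon.eq _).1 hxyz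
    exact (AddCon.eq _).2 ⟨c + x, by rw [add_assoc, hc, add_assoc]⟩
  · rintro ⟨c, h⟩ d hd
    have hd' : IsLeftCancelAdd d.Quotient := hd
    refine (AddCon.eq _).1 (add_left_cancel (a := (c : d.Quotient)) ?_)
    exact congrArg ((↑) : N → d.Quotient) h

/-- If the pairs that become equal after some left translation form a congruence, it is the least
left cancellative one. -/
theorem leastLeftCancelCon_iff {N : Type*} [Monoid N] (E : Con N)
    (hE : ∀ a b, E a b ↔ ∃ c, c * a = c * b) (a b : N) :
    leastLeftCancelCon N a b ↔ ∃ c, c * a = c * b := by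
  constructor
  · refine fun h => (hE a b).1 (h E (⟨fun x y z hxyz => ?_⟩ : IsLeftCancelMul E.Quotient))
    induction x using Con.induction_on with | _ x
    induction y using Con.induction_on with | _ y
    induction z using Con.induction_on with | _ z
    obtain ⟨c, hc⟩ := (hE (x * y) (x * z)).1 ((Con.eq _).1 hxyz)
    exact (Con.eq _).2 ((hE y z).2 ⟨c * x, by rw [mul_assoc, hc, mul_assoc]⟩)
  · rintro ⟨c, h⟩ d hd
    have hd' : IsLeftCancelMul d.Quotient := hd
    refine (Con.eq _).1 (mul_left_cancel (a := (c : d.Quotient)) ?_)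
    exact congrArg ((↑) : N → d.Quotient) h

namespace LeftNonDegSolution

variable {X : Type*} (S : LeftNonDegSolution X)

/-! ### The inclusion `d + M ⊆ M + d` -/

theorem exists_ofA_add_ofA_eq (hr : Function.Surjective S.r) (x y : X) :
    ∃ x', S.ofA x' + S.ofA y = S.ofA y + S.ofA x := by
  -- This preimage makes the relation `u + σ_u(v) = σ_u(v) + σ_{σ_u(v)}(γ_v(u))` read `u + y = y +
  -- x`.
  obtain ⟨⟨u, v⟩, h⟩ := hr (y, (S.sig y).symm x)
  have h1 : S.sig u v = y := congrArg Prod.fst h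
  have h2 : S.gam v u = (S.sig y).symm x := congrArg Prod.snd h
  refine ⟨u, ?_⟩
  have := S.ofA_add_ofA u v
  rwa [h1, h2, Equiv.apply_symm_apply] at this

theorem exists_add_eq_add_A (hr : Function.Surjective S.r) (d c : S.A) :
    ∃ c', c' + d = d + c := by
  induction d using S.A_ind generalizing c with
  | h0 => exact ⟨c, by simp⟩
  | ha y d ih =>
    have key (e : S.A) : ∃ e', e' + S.ofA y = S.ofA y + e := by
      induction e using S.A_ind with
      | h0 => exact ⟨0, by simp⟩
      | ha x e ih =>
        obtain ⟨e', he⟩ := ih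
        obtain ⟨x', hx⟩ := S.exists_ofA_add_ofA_eq hr x y
        exact ⟨S.ofA x' + e', by rw [add_assoc, he, ← add_assoc, hx, add_assoc]⟩
    obtain ⟨e, he⟩ := ih c
    obtain ⟨e', he'⟩ := key e
    exact ⟨e', by rw [← add_assoc, he', add_assoc, he, add_assoc]⟩

theorem exists_add_eq_add (hr : Function.Surjective S.r) (d c : S.M) :
    ∃ c', c' + d = d + c := by
  obtain ⟨e, he⟩ := S.exists_add_eq_add_A hr (S.cocycleAddEquiv d) (S.cocycleAddEquiv c)
  refine ⟨S.cocycleAddEquiv.symm e, S.cocycleAddEquiv.injective ?_⟩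
  rw [map_add, map_add, AddEquiv.apply_symm_apply, he]

/-! ### Surjectivity of the diagonal map, on `X` and on `M` -/

/-- The diagonal map `x ↦ σ_x⁻¹(x)` is surjective. -/
theorem exists_sig_apply_eq_self (hright : IsRightNonDegenerate S.r) (y : X) :
    ∃ x, S.sig x y = x := by
  -- With `γ_y(z) = y`, the identity `σ_{σ_z(y)} σ_{γ_y(z)} = σ_z σ_y` evaluated at `σ_y⁻¹(y)`
  -- becomes `σ_{σ_z(y)}(y) = σ_z(y)`.
  obtain ⟨z, hz⟩ := (hright y).surjective y
  have hz' : S.gam y z = y := hz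
  refine ⟨S.sig z y, ?_⟩
  have h := S.braid1 z y ((S.sig y).symm y)
  rwa [hz', Equiv.apply_symm_apply] at h

theorem exists_lamA_ofA (b : S.M) (x : X) : ∃ y, S.lamA b (S.ofA x) = S.ofA y := by
  induction b using S.M_ind with
  | h1 => exact ⟨x, S.lamA_one _⟩
  | hm z b ih =>
    obtain ⟨y, hy⟩ := ih
    exact ⟨S.sig z y, by rw [lamA_mul, hy, lamA_of, sigA_of]⟩

/-- The element `b` is built one generator at a time: if `b` serves `c`, `λ_b(x) = y` and `σ_z(y) =
z`, then `λ_{z ∘ b}(x + c) = σ_z(y + π(b)) = z + σ_z(π(b)) = π(z ∘ b)`. -/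
theorem exists_lamA_eq_cocycle (hright : IsRightNonDegenerate S.r) (c : S.A) :
    ∃ b, S.lamA b c = S.cocycle b := by
  induction c using S.A_ind with
  | h0 => exact ⟨1, by rw [map_zero, cocycle_one]⟩
  | ha x c ih =>
    obtain ⟨b, hb⟩ := ih
    obtain ⟨y, hy⟩ := S.exists_lamA_ofA b x
    obtain ⟨z, hz⟩ := S.exists_sig_apply_eq_self hright y
    refine ⟨S.of z * b, ?_⟩
    rw [lamA_mul, map_add, hy, hb, lamA_of, map_add, sigA_of, hz, cocycle_of_mul]

/-- The map `b ↦ (λ'_b)⁻¹(b)` is surjective. -/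
theorem exists_lam_eq_self (hright : IsRightNonDegenerate S.r) (c : S.M) :
    ∃ b, S.lam b c = b := by
  obtain ⟨b, hb⟩ := S.exists_lamA_eq_cocycle hright (S.cocycleAddEquiv c)
  exact ⟨b, S.cocycleAddEquiv.symm_apply_eq.2 hb⟩

/-! ### Comparison of the two congruences -/

theorem exists_mul_eq_mul_iff (hright : IsRightNonDegenerate S.r) (a b : S.M) :
    (∃ c, c * a = c * b) ↔ ∃ c, c + a = c + b := by
  constructor
  · rintro ⟨c, h⟩
    rw [mul_eq_add_lam, mul_eq_add_lam] at h
    refine ⟨(S.lam c).symm c, (S.lam c).injective ?_⟩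
    simpa using h
  · rintro ⟨c, h⟩
    -- Applying `λ'_d` turns the translation by `c` into the translation by `d = λ'_d(c)`, which is
    -- what `d ∘ a` requires.
    obtain ⟨d, hd⟩ := S.exists_lam_eq_self hright c
    refine ⟨d, ?_⟩
    have h' := congrArg (S.lam d) h
    rw [map_add, map_add, hd] at h'
    rw [mul_eq_add_lam, mul_eq_add_lam, h']

/-- `λ'` is multiplicative with invertible values, so the common factor `λ'_c` cancels. -/
theorem lam_eq_of_mul_eq_mul {a b c : S.M} (h : c * a = c * b) : S.lam a = S.lam b :=
  AddEquiv.ext fun x => (S.lam c).injective (by rw [← lam_mul, h, lam_mul])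

theorem eta_iff (hr : Function.Surjective S.r) (a b : S.M) :
    S.eta a b ↔ ∃ c, c + a = c + b :=
  leastLeftCancelAddCon_iff (S.exists_add_eq_add hr) a b

theorem lam_eq_of_eta (hr : Function.Surjective S.r) (hright : IsRightNonDegenerate S.r)
    {a b : S.M} (h : S.eta a b) : S.lam a = S.lam b := by
  obtain ⟨c, hc⟩ := (S.exists_mul_eq_mul_iff hright a b).2 ((S.eta_iff hr a b).1 h)
  exact S.lam_eq_of_mul_eq_mul hc

theorem eta_lam (hr : Function.Surjective S.r) (z : S.M) {a b : S.M} (h : S.eta a b) :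
    S.eta (S.lam z a) (S.lam z b) := by
  obtain ⟨c, hc⟩ := (S.eta_iff hr a b).1 h
  exact (S.eta_iff hr _ _).2 ⟨S.lam z c, by rw [← map_add, hc, map_add]⟩

theorem eta_lam_symm (hr : Function.Surjective S.r) (z : S.M) {a b : S.M} (h : S.eta a b) :
    S.eta ((S.lam z).symm a) ((S.lam z).symm b) := by
  obtain ⟨c, hc⟩ := (S.eta_iff hr a b).1 h
  exact (S.eta_iff hr _ _).2 ⟨(S.lam z).symm c, by rw [← map_add, hc, map_add]⟩

theorem eta_mul (hr : Function.Surjective S.r) (hright : IsRightNonDegenerate S.r)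
    {a b c d : S.M} (h : S.eta a b) (h' : S.eta c d) : S.eta (a * c) (b * d) := by
  rw [mul_eq_add_lam, mul_eq_add_lam, S.lam_eq_of_eta hr hright h]
  exact S.eta.add h (S.eta_lam hr b h')

theorem eta_iff_nu (hr : Function.Surjective S.r) (hright : IsRightNonDegenerate S.r)
    (a b : S.M) : S.eta a b ↔ S.nu a b := by
  -- `η` itself, now as a congruence for `∘`.
  let E : Con S.M := { S.eta.toSetoid with mul' := S.eta_mul hr hright }
  have hE (a b : S.M) : E a b ↔ ∃ c, c * a = c * b :=
    (S.eta_iff hr a b).trans (S.exists_mul_eq_mul_iff hright a b).symm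
  exact (hE a b).trans (leastLeftCancelCon_iff E hE a b).symm

end LeftNonDegSolution

end YangBaxter

theorem proposition6 {X : Type*} (S : YangBaxter.LeftNonDegSolution X)
    (hbij : Function.Bijective S.r) (hright : YangBaxter.IsRightNonDegenerate S.r) :
    (∀ a b : S.M, S.eta a b ↔ S.nu a b) ∧
    (∀ z : S.M,
      {p : S.M × S.M | S.nu p.1 p.2} =
        {p : S.M × S.M | ∃ a b, S.nu a b ∧ p = (S.lam z a, S.lam z b)} ∧
      {p : S.M × S.M | S.nu p.1 p.2} =
        {p : S.M × S.M | ∃ a b, S.nu a b ∧ p = ((S.lam z).symm a, (S.lam z).symm b)}) ∧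
    (∀ a b : S.M, S.eta a b → S.lam a = S.lam b) := by
  have hr := hbij.surjective
  refine ⟨S.eta_iff_nu hr hright, fun z => ?_, fun a b => S.lam_eq_of_eta hr hright⟩
  simp only [← S.eta_iff_nu hr hright]
  constructor
  · ext ⟨a, b⟩
    constructor
    · exact fun h => ⟨_, _, S.eta_lam_symm hr z h, by simp⟩
    · rintro ⟨a', b', h, heq⟩
      obtain ⟨rfl, rfl⟩ := Prod.mk.inj heq
      exact S.eta_lam hr z h
  · ext ⟨a, b⟩
    constructor
    · exact fun h => ⟨_, _, S.eta_lam hr z h, by simp⟩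
    · rintro ⟨a', b', h, heq⟩
      obtain ⟨rfl, rfl⟩ := Prod.mk.inj heq
      exact S.eta_lam_symm hr z h
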